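/- Throughout, a *strong proximity* on a topological space $X$ is a relation $\delta$ between subsets of $X$ such that, for all $A,B\subseteq X$ and $x,y\in X$: $\emptyset$ is not near $A$; $X\,\delta\,A$ if $A\ne\emptyset$; $A\,\delta\,B\Leftrightarrow B\,\delta\,A$; $A\,\delta\,B$ implies $A\cap B\neq\emptyset$; if $A\,\delta\,B$ for some member $B$ with nonempty interior of a family $\mathcal B$ of subsets of $X$, then $A\,\delta\,\bigcup\mathcal B$; $\operatorname{int}A\cap\operatorname{int}B\ne\emptyset$ implies $A\,\delta\,B$; $x\in\operatorname{int}A$ implies $\{x\}\,\delta\,A$; and $\{x\}\,\delta\,\{y\}\Leftrightarrow x=y$. (For instance, "$A$ and $B$ have a common point" is a strong proximity.) Let $S$ be a set of points of the Euclidean plane $E$, and let $\mathscr X=\{V(s):s\in S\}$ be its Voronoï tessellation, where $V(s)=\{x\in E:\|x-s\|\le\|x-q\|\text{ for all }q\in S\}$. Let $\delta$ be a strong proximity on $E$. The *nucleus cluster* of $M\in\mathscr X$ is $\mathfrak C M=\{A\in\mathscr X: A\,\delta\,M\}$. Let $N\in\mathscr X$ be such that $\mathfrak C N$ is *maximal*,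 i.e. no $M\in\mathscr X$ has more adjacent regions (elements of $\mathfrak C M\setminus\{M\}$) than $N$ has, and assume that $\mathfrak C N$ is finite. Let the *MNC nerve* $\mathrm{Nrv}\,\mathscr F_{MNC}$ be the Edelsbrunner–Harer nerve of the family $\mathscr F_{MNC}=\mathfrak C N$, that is, the abstract simplicial complex whose simplices are the nonempty subcollections $\mathscr S\subseteq\mathfrak C N$ with $\bigcap_{A\in\mathscr S}A\neq\emptyset$ (every $A\in\mathscr S$ is then a region with $N\,\delta\,A$). **Theorem.** The geometric realization of $\mathrm{Nrv}\,\mathscr F_{MNC}$ and the union $\bigcup_{A\in\mathfrak C N}A\subseteq E$ have the same homotopy type. -/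

import Mathlib

open Set

/-- A relation `δ` on the subsets of a topological space `X` is a strong proximity.
In `univ_near` the set is nonempty, since the empty set is near to no set. -/
structure IsStrongProximity {X : Type*} [TopologicalSpace X]
    (δ : Set X → Set X → Prop) : Prop where
  empty_far : ∀ A : Set X, ¬ δ ∅ A
  univ_near : ∀ A : Set X, A.Nonempty → δ univ A
  symm : ∀ A B : Set X, δ A B ↔ δ B A
  inter_nonempty : ∀ A B : Set X, δ A B → (A ∩ B).Nonempty
  sUnion_near : ∀ (A : Set X) (ℬ : Set (Set X)) (B : Set X), B ∈ ℬ → δ A B →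
    (interior B).Nonempty → δ A (⋃₀ ℬ)
  near_of_interior : ∀ A B : Set X, (interior A ∩ interior B).Nonempty → δ A B
  near_of_mem_interior : ∀ (x : X) (A : Set X), x ∈ interior A → δ {x} A
  singleton_near_iff : ∀ x y : X, δ {x} {y} ↔ x = y

/-- The Euclidean plane. -/
abbrev Plane : Type := EuclideanSpace ℝ (Fin 2)

/-- The Voronoi region of the site `s` with respect to the set `S` of generating points. -/
def voronoiRegion (S : Set Plane) (s : Plane) : Set Plane :=
  {x | ∀ q ∈ S, ‖x - s‖ ≤ ‖x - q‖}

/-- The Voronoi tessellation generated by `S`: the collection of the regions of its points. -/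
def voronoiTessellation (S : Set Plane) : Set (Set Plane) :=
  {A | ∃ s ∈ S, A = voronoiRegion S s}

/-- The nucleus cluster of `N` in a collection `𝒳` of regions: the regions strongly near `N`. -/
def nucleusCluster (δ : Set Plane → Set Plane → Prop) (𝒳 : Set (Set Plane)) (N : Set Plane) :
    Set (Set Plane) :=
  {A | A ∈ 𝒳 ∧ δ A N}

/-- `N` is the nucleus of a maximal nucleus cluster: no region of `𝒳` has more adjacent
(strongly near, other than the region itself) regions than `N` has. -/
def IsMaximalNucleus (δ : Set Plane → Set Plane → Prop) (𝒳 : Set (Set Plane))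
    (N : Set Plane) : Prop :=
  N ∈ 𝒳 ∧ ∀ M ∈ 𝒳,
    (nucleusCluster δ 𝒳 M \ {M}).encard ≤ (nucleusCluster δ 𝒳 N \ {N}).encard

/-- The Edelsbrunner-Harer nerve of a collection `ℱ` of sets: the abstract simplicial complex of
the nonempty finite subcollections of `ℱ` whose members have a common point. -/
def edelsbrunnerHarerNerve {X : Type*} (ℱ : Set (Set X)) :
    PreAbstractSimplicialComplex (Set X) where
  faces := {σ | σ.Nonempty ∧ (σ : Set (Set X)) ⊆ ℱ ∧ (⋂₀ (σ : Set (Set X))).Nonempty}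
  isRelLowerSet_faces := by
    rintro σ ⟨hne, hF, x, hx⟩
    refine ⟨hne, fun τ hτ hτne => ⟨hτne, fun A hA => hF (hτ hA), x, fun A hA => hx A (hτ hA)⟩⟩

/-- The nerve of the nucleus cluster of `N`: the members of a simplex are regions of the cluster,
each of them strongly near the nucleus (a spoke), and they have a common point. -/
def mncNerve (δ : Set Plane → Set Plane → Prop) (𝒳 : Set (Set Plane)) (N : Set Plane) :
    PreAbstractSimplicialComplex (Set Plane) where
  faces := {σ | σ ∈ (edelsbrunnerHarerNerve (nucleusCluster δ 𝒳 N)).faces ∧ ∀ A ∈ σ, δ N A}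
  isRelLowerSet_faces := by
    rintro σ ⟨hσ, hN⟩
    have h := (edelsbrunnerHarerNerve (nucleusCluster δ 𝒳 N)).isRelLowerSet_faces hσ
    exact ⟨h.1, fun τ hτ hτne => ⟨h.2 hτ hτne, fun A hA => hN A (hτ hA)⟩⟩

/-- The underlying space of an abstract simplicial complex with finitely many simplices: the
points are the barycentric coordinates supported on a simplex, with the topology of `ι → ℝ`. -/
def geometricRealization {ι : Type*} (K : PreAbstractSimplicialComplex ι) : Set (ι → ℝ) :=
  {w | (∀ i, 0 ≤ w i) ∧ ∃ σ ∈ K.faces, (∀ i, i ∉ σ → w i = 0) ∧ ∑ i ∈ σ, w i = 1}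

/-! Voronoi regions are intersections of closed half-planes and contain their sites, so the theorem
is the nerve theorem for a finite family of `n` nonempty closed convex sets; symmetry of `δ` makes
the spoke condition automatic. A map `g` to the nerve normalizes bump functions of thickenings too
thin to create new intersections (`exists_map_to_nerve`). A map `f` back averages common points of
subfamilies (`exists_map_from_nerve`). The threshold `ε = 1/(n+1)` links them: `f w` lies in each
`A` with `w A ≥ ε`, and `g x` exceeds `ε` at each `A` containing `x`. So `x` and `f (g x)` share a
convex member, while `g (f w)` and the truncation of `w` at `ε` share a simplex; straight-line
homotopies finish. -/

section Nerve

open Metric Classical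

/-! ### Straight-line homotopies and thickenings -/

/-- Maps into a subset of a topological vector space are homotopic if the segments joining
corresponding values stay in the subset. -/
theorem ContinuousMap.homotopic_of_segment_subset {Y V : Type*} [TopologicalSpace Y]
    [AddCommGroup V] [Module ℝ V] [TopologicalSpace V] [ContinuousAdd V] [ContinuousSMul ℝ V]
    {Z : Set V} (f g : C(Y, Z)) (h : ∀ y, segment ℝ (f y : V) (g y) ⊆ Z) :
    f.Homotopic g := by
  refine ⟨⟨⟨fun p => ⟨(1 - (p.1 : ℝ)) • (f p.2 : V) + (p.1 : ℝ) • (g p.2 : V),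
    h p.2 ⟨1 - p.1, p.1, by linarith [p.1.2.2], p.1.2.1, by ring, rfl⟩⟩, ?_⟩, ?_, ?_⟩⟩
  · exact Continuous.subtype_mk (by fun_prop) _
  · intro y; ext; simp
  · intro y; ext; simp

/-- Finitely many positive continuous functions have a positive continuous lower bound. -/
theorem Finset.exists_continuous_pos_le {X κ : Type*} [TopologicalSpace X] (s : Finset κ)
    (f : κ → X → ℝ) (hc : ∀ k ∈ s, Continuous (f k)) (hp : ∀ k ∈ s, ∀ x, 0 < f k x) :
    ∃ ρ : X → ℝ, Continuous ρ ∧ (∀ x, 0 < ρ x) ∧ ∀ k ∈ s, ∀ x, ρ x ≤ f k x := by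
  induction s using Finset.induction_on with
  | empty => exact ⟨fun _ => 1, continuous_const, fun _ => one_pos, by simp⟩
  | insert a s _ ih =>
    obtain ⟨ρ, h1, h2, h3⟩ := ih (fun k hk => hc k (Finset.mem_insert_of_mem hk))
      (fun k hk => hp k (Finset.mem_insert_of_mem hk))
    refine ⟨fun x => min (f a x) (ρ x), (hc a (Finset.mem_insert_self a s)).min h1,
      fun x => lt_min (hp a (Finset.mem_insert_self a s) x) (h2 x), fun k hk x => ?_⟩
    rcases Finset.mem_insert.1 hk with rfl | hk
    · exact min_le_left _ _
    · exact (min_le_right _ _).trans (h3 k hk x)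

/-- A finite family of closed sets has a variable thickening with the same nerve. -/
theorem exists_thickening_with_same_nerve {X : Type*} [PseudoMetricSpace X] (F : Finset (Set X))
    (hcl : ∀ A ∈ F, IsClosed A) (hne : ∀ A ∈ F, A.Nonempty) :
    ∃ ρ : X → ℝ, Continuous ρ ∧ (∀ x, 0 < ρ x) ∧ ∀ x, ∀ τ ⊆ F, τ.Nonempty →
      (∀ A ∈ τ, infDist x A < ρ x) → ∃ y, ∀ A ∈ τ, y ∈ A := by
  -- `ρ` lies below the mean distance to each subfamily without a common point, which is positive
  -- because the members are closed. Not all members can be closer than their mean distance.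
  obtain ⟨ρ, h1, h2, h3⟩ := Finset.exists_continuous_pos_le
    (F.powerset.filter fun τ => τ.Nonempty ∧ ¬ ∃ y, ∀ A ∈ τ, y ∈ A)
    (fun τ x => (∑ A ∈ τ, infDist x A) / τ.card)
    (fun τ _ => (continuous_finsetSum _ fun A _ => continuous_infDist_pt A).div_const _)
    (by
      intro τ hτ x
      simp only [Finset.mem_filter, Finset.mem_powerset] at hτ
      obtain ⟨hτF, hτne, hτ⟩ := hτ
      refine div_pos ?_ (by exact_mod_cast hτne.card_pos)
      push Not at hτ
      obtain ⟨A, hA, hxA⟩ := hτ x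
      exact Finset.sum_pos' (fun B _ => infDist_nonneg)
        ⟨A, hA, ((hcl A (hτF hA)).notMem_iff_infDist_pos (hne A (hτF hA))).1 hxA⟩)
  refine ⟨ρ, h1, h2, fun x τ hτF hτne hτ => ?_⟩
  by_contra hcon
  have h4 := h3 τ (by simp only [Finset.mem_filter, Finset.mem_powerset]; exact ⟨hτF, hτne, hcon⟩) x
  rw [le_div_iff₀ (by exact_mod_cast hτne.card_pos)] at h4
  have h5 := Finset.sum_lt_sum_of_nonempty hτne hτ
  rw [Finset.sum_const, nsmul_eq_mul] at h5
  linarith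

/-! ### Coordinates in the realization -/

/-- Points of the realization of the nerve of a finite family, in terms of their supports. -/
theorem mem_geometricRealization_nerve {X : Type*} (F : Finset (Set X)) (w : Set X → ℝ) :
    w ∈ geometricRealization (edelsbrunnerHarerNerve (F : Set (Set X))) ↔
      (∀ A, 0 ≤ w A) ∧ (∀ A ∉ F, w A = 0) ∧ ∑ A ∈ F, w A = 1 ∧ ∃ x, ∀ A, 0 < w A → x ∈ A := by
  constructor
  · rintro ⟨h0, σ, ⟨hne, hσF, x, hx⟩, hoff, hsum⟩
    have hσF' : σ ⊆ F := fun A hA => hσF hA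
    refine ⟨h0, fun A hA => hoff A fun h => hA (hσF' h), ?_, x, fun A hA => ?_⟩
    · rw [← hsum]
      exact (Finset.sum_subset hσF' fun A _ hA => hoff A hA).symm
    · by_contra hxA
      exact hA.ne' (hoff A fun h => hxA (hx A h))
  · rintro ⟨h0, hoff, hsum, x, hx⟩
    have hsupp : ∀ A ∉ F.filter fun A => 0 < w A, w A = 0 := by
      intro A hA
      by_cases hAF : A ∈ F
      · exact le_antisymm (not_lt.1 fun h => hA (Finset.mem_filter.2 ⟨hAF, h⟩)) (h0 A)
      · exact hoff A hAF
    have hs : ∑ A ∈ F.filter (fun A => 0 < w A), w A = 1 := by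
      rw [← hsum]
      exact Finset.sum_subset (Finset.filter_subset _ _) fun A _ hA => hsupp A hA
    refine ⟨h0, F.filter fun A => 0 < w A, ⟨?_, ?_, x, ?_⟩, hsupp, hs⟩
    · rw [Finset.nonempty_iff_ne_empty]
      intro h
      rw [h] at hs
      simp at hs
    · exact fun A hA => (Finset.mem_filter.1 hA).1
    · exact fun A hA => hx A (Finset.mem_filter.1 hA).2

/-- Normalizing nonnegative weights whose support has a common point gives a point of the
realization of the nerve. -/
theorem div_sum_mem_geometricRealization_nerve {X : Type*} (F : Finset (Set X)) (v : Set X → ℝ)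
    (h0 : ∀ A, 0 ≤ v A) (hoff : ∀ A ∉ F, v A = 0) (hpos : 0 < ∑ A ∈ F, v A)
    (hx : ∃ x, ∀ A, 0 < v A → x ∈ A) :
    (fun A => v A / ∑ B ∈ F, v B) ∈
      geometricRealization (edelsbrunnerHarerNerve (F : Set (Set X))) := by
  rw [mem_geometricRealization_nerve]
  refine ⟨fun A => div_nonneg (h0 A) hpos.le, fun A hA => by simp [hoff A hA], ?_, ?_⟩
  · rw [← Finset.sum_div, div_self hpos.ne']
  · obtain ⟨x, hx⟩ := hx
    exact ⟨x, fun A hA => hx A ((div_pos_iff_of_pos_right hpos).1 hA)⟩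

/-- Segments stay in the realization when both ends are supported on a common simplex. -/
theorem segment_subset_geometricRealization_nerve {X : Type*} (F : Finset (Set X))
    {v w : Set X → ℝ}
    (hv : v ∈ geometricRealization (edelsbrunnerHarerNerve (F : Set (Set X))))
    (hw : w ∈ geometricRealization (edelsbrunnerHarerNerve (F : Set (Set X))))
    (hsupp : ∀ A, 0 < w A → 0 < v A) :
    segment ℝ v w ⊆ geometricRealization (edelsbrunnerHarerNerve (F : Set (Set X))) := by
  rintro _ ⟨a, b, ha, hb, hab, rfl⟩
  rw [mem_geometricRealization_nerve] at hv hw ⊢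
  obtain ⟨hv0, hvoff, hvs, x, hx⟩ := hv
  obtain ⟨hw0, hwoff, hws, -⟩ := hw
  refine ⟨fun A => ?_, fun A hA => ?_, ?_, x, fun A hA => hx A ?_⟩
  · simpa using add_nonneg (mul_nonneg ha (hv0 A)) (mul_nonneg hb (hw0 A))
  · simp [hvoff A hA, hwoff A hA]
  · simp only [Pi.add_apply, Pi.smul_apply, smul_eq_mul, Finset.sum_add_distrib, ← Finset.mul_sum,
      hvs, hws, mul_one, hab]
  · by_contra hvA
    have h1 : v A = 0 := le_antisymm (not_lt.1 hvA) (hv0 A)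
    have h2 : w A = 0 := le_antisymm (not_lt.1 fun h => hvA (hsupp A h)) (hw0 A)
    simp [h1, h2] at hA

/-! ### Maps between the union and the nerve -/

variable {E : Type*} [NormedAddCommGroup E] [NormedSpace ℝ E]

/-- There is a map from the union of a finite family of closed sets to the realization of its
nerve whose largest coordinates at a point belong to the sets that contain the point. -/
theorem exists_map_to_nerve {X : Type*} [PseudoMetricSpace X] (F : Finset (Set X))
    (hcl : ∀ A ∈ F, IsClosed A) (hne : ∀ A ∈ F, A.Nonempty) :
    ∃ g : C(⋃₀ (F : Set (Set X)),
        geometricRealization (edelsbrunnerHarerNerve (F : Set (Set X)))),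
      ∀ x : ⋃₀ (F : Set (Set X)), ∀ A ∈ F, (x : X) ∈ A → 1 / (F.card + 1 : ℝ) < (g x : Set X → ℝ) A := by
  obtain ⟨ρ, hρc, hρ, hnerve⟩ := exists_thickening_with_same_nerve F hcl hne
  let v : X → Set X → ℝ := fun x A => if A ∈ F then max 0 (ρ x - infDist x A) else 0
  have hv0 : ∀ x A, 0 ≤ v x A := by
    intro x A
    simp only [v]
    split_ifs
    exacts [le_max_left _ _, le_rfl]
  have hvoff : ∀ x, ∀ A ∉ F, v x A = 0 := fun x A hA => by simp [v, hA]
  have hvle : ∀ x A, v x A ≤ ρ x := by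
    intro x A
    simp only [v]
    split_ifs
    · exact max_le (hρ x).le (by linarith [infDist_nonneg (x := x) (s := A)])
    · exact (hρ x).le
  have hveq : ∀ x, ∀ A ∈ F, x ∈ A → v x A = ρ x := fun x A hA hx => by
    simp [v, hA, infDist_zero_of_mem hx, (hρ x).le]
  have hsupp : ∀ x A, 0 < v x A → A ∈ F ∧ infDist x A < ρ x := by
    intro x A h
    have hA : A ∈ F := by
      by_contra hA
      exact h.ne' (hvoff x A hA)
    refine ⟨hA, ?_⟩
    simp only [v, if_pos hA, lt_max_iff, lt_irrefl, false_or] at h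
    linarith
  have hpos : ∀ x ∈ ⋃₀ (F : Set (Set X)), 0 < ∑ A ∈ F, v x A := by
    rintro x ⟨A, hA, hx⟩
    exact Finset.sum_pos' (fun B _ => hv0 x B) ⟨A, hA, by rw [hveq x A hA hx]; exact hρ x⟩
  have hcomm : ∀ x ∈ ⋃₀ (F : Set (Set X)), ∃ y, ∀ A, 0 < v x A → y ∈ A := by
    rintro x ⟨A, hA, hx⟩
    obtain ⟨y, hy⟩ := hnerve x (F.filter fun A => 0 < v x A) (Finset.filter_subset _ _)
      ⟨A, Finset.mem_filter.2 ⟨hA, by rw [hveq x A hA hx]; exact hρ x⟩⟩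
      (fun B hB => (hsupp x B (Finset.mem_filter.1 hB).2).2)
    exact ⟨y, fun B hB => hy B (Finset.mem_filter.2 ⟨(hsupp x B hB).1, hB⟩)⟩
  have hvc : ∀ A, Continuous fun x => v x A := by
    intro A
    by_cases hA : A ∈ F
    · simp only [v, if_pos hA]
      exact continuous_const.max (hρc.sub (continuous_infDist_pt A))
    · simp only [v, if_neg hA]
      exact continuous_const
  refine ⟨⟨fun x => ⟨fun A => v x A / ∑ B ∈ F, v x B,
    div_sum_mem_geometricRealization_nerve F (v x) (hv0 x) (hvoff x) (hpos x x.2)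
      (hcomm x x.2)⟩, ?_⟩, fun x A hA hx => ?_⟩
  · refine Continuous.subtype_mk (continuous_pi fun A => ?_) _
    exact ((hvc A).comp continuous_subtype_val).div
      ((continuous_finsetSum F fun B _ => hvc B).comp continuous_subtype_val)
      fun x => (hpos x x.2).ne'
  · change 1 / (F.card + 1 : ℝ) < v x A / ∑ B ∈ F, v x B
    -- The numerator attains the maximum `ρ x` and the sum has `F.card` terms, so the quotient is at
    -- least `1 / F.card`; the `+ 1` makes the bound strict.
    rw [div_lt_div_iff₀ (by positivity) (hpos x x.2), hveq x A hA hx, one_mul]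
    have h1 : ∑ B ∈ F, v x B ≤ F.card * ρ x := by
      simpa using Finset.sum_le_card_nsmul F (v x) (ρ x) fun B _ => hvle x B
    linarith [hρ (x : X)]

/-- There is a map from the realization of the nerve of a finite family of convex sets to its
union that sends a point into each set at which the coordinate of the point is not small. -/
theorem exists_map_from_nerve (F : Finset (Set E)) (hconv : ∀ A ∈ F, Convex ℝ A) :
    ∃ f : C(geometricRealization (edelsbrunnerHarerNerve (F : Set (Set E))),
        ⋃₀ (F : Set (Set E))),
      ∀ w : geometricRealization (edelsbrunnerHarerNerve (F : Set (Set E))),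
        ∀ A ∈ F, 1 / (F.card + 1 : ℝ) ≤ (w : Set E → ℝ) A → (f w : E) ∈ A := by
  set ε : ℝ := 1 / (F.card + 1 : ℝ) with hε
  have hε0 : 0 < ε := by positivity
  -- The default `0` is harmless: on the realization, subfamilies without a common point get weight
  -- zero.
  let p : Finset (Set E) → E := fun σ => if h : ∃ y, ∀ A ∈ σ, y ∈ A then h.choose else 0
  have hp : ∀ σ : Finset (Set E), (∃ y, ∀ A ∈ σ, y ∈ A) → ∀ A ∈ σ, p σ ∈ A := by
    intro σ h
    simp only [p, dif_pos h]
    exact h.choose_spec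
  -- A nonzero weight forces `σ` to lie in the support of `w` and to contain every `A` with `ε ≤ w
  -- A`.
  let c : (Set E → ℝ) → Finset (Set E) → ℝ :=
    fun w σ => (∏ A ∈ σ, w A) * ∏ A ∈ F \ σ, max 0 (ε - w A)
  have hcc : ∀ σ, Continuous fun w => c w σ := by
    intro σ
    simp only [c]
    fun_prop
  let f : (Set E → ℝ) → E := fun w => F.powerset.centerMass (c w) p
  have hc0 : ∀ w : Set E → ℝ, (∀ A, 0 ≤ w A) → ∀ σ, 0 ≤ c w σ := fun w hw σ =>
    mul_nonneg (Finset.prod_nonneg fun A _ => hw A) (Finset.prod_nonneg fun A _ => le_max_left _ _)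
  have hpos : ∀ w : Set E → ℝ, (∀ A, 0 ≤ w A) → 0 < ∑ σ ∈ F.powerset, c w σ := by
    intro w hw
    refine Finset.sum_pos' (fun σ _ => hc0 w hw σ)
      ⟨F.filter fun A => ε ≤ w A, Finset.mem_powerset.2 (Finset.filter_subset _ _), ?_⟩
    refine mul_pos (Finset.prod_pos fun A hA => hε0.trans_le (Finset.mem_filter.1 hA).2)
      (Finset.prod_pos fun A hA => ?_)
    rw [Finset.mem_sdiff, Finset.mem_filter, not_and, not_le] at hA
    exact lt_max_of_lt_right (sub_pos.2 (hA.2 hA.1))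
  have hmem : ∀ w ∈ geometricRealization (edelsbrunnerHarerNerve (F : Set (Set E))),
      ∀ A ∈ F, ε ≤ w A → f w ∈ A := by
    intro w hw A hA hwA
    rw [mem_geometricRealization_nerve] at hw
    obtain ⟨hw0, -, -, y, hy⟩ := hw
    have hf : f w = (F.powerset.filter fun σ => c w σ ≠ 0).centerMass (c w) p :=
      (Finset.centerMass_filter_ne_zero p).symm
    rw [hf]
    refine (hconv A hA).centerMass_mem (fun σ _ => hc0 w hw0 σ) ?_ fun σ hσ => ?_
    · rw [Finset.sum_filter_ne_zero]
      exact hpos w hw0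
    · have hcσ := mul_ne_zero_iff.1 (Finset.mem_filter.1 hσ).2
      refine hp σ ⟨y, fun B hB => hy B ?_⟩ A ?_
      · exact (hw0 B).lt_of_ne' (Finset.prod_ne_zero_iff.1 hcσ.1 B hB)
      · by_contra hAσ
        exact Finset.prod_ne_zero_iff.1 hcσ.2 A (Finset.mem_sdiff.2 ⟨hA, hAσ⟩)
          (max_eq_left (sub_nonpos.2 hwA))
  have hunion : ∀ w ∈ geometricRealization (edelsbrunnerHarerNerve (F : Set (Set E))),
      f w ∈ ⋃₀ (F : Set (Set E)) := by
    intro w hw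
    obtain ⟨-, -, hsum, -⟩ := (mem_geometricRealization_nerve F w).1 hw
    -- `F.card` coordinates below `1 / (F.card + 1)` cannot sum to 1.
    obtain ⟨A, hA, hwA⟩ : ∃ A ∈ F, ε ≤ w A := by
      by_contra! hcon
      have h1 := Finset.sum_le_card_nsmul F w ε fun A hA => (hcon A hA).le
      rw [hsum, nsmul_eq_mul, hε, mul_one_div, le_div_iff₀ (by positivity)] at h1
      linarith
    exact ⟨A, hA, hmem w hw A hA hwA⟩
  refine ⟨⟨fun w => ⟨f w, hunion w w.2⟩, Continuous.subtype_mk ?_ _⟩, fun w => hmem w w.2⟩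
  simp only [f, Finset.centerMass]
  refine Continuous.smul (Continuous.inv₀ ?_ fun w => (hpos (w : Set E → ℝ) w.2.1).ne') ?_
  · exact continuous_finsetSum _ fun σ _ => (hcc σ).comp continuous_subtype_val
  · exact continuous_finsetSum _ fun σ _ =>
      ((hcc σ).comp continuous_subtype_val).smul continuous_const

/-- The realization of the nerve of a finite family can be deformed so that the small coordinates
vanish. -/
theorem exists_homotopic_id_truncating {X : Type*} (F : Finset (Set X)) :
    ∃ t : C(geometricRealization (edelsbrunnerHarerNerve (F : Set (Set X))),
        geometricRealization (edelsbrunnerHarerNerve (F : Set (Set X)))),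
      (ContinuousMap.id _).Homotopic t ∧
      ∀ (w : geometricRealization (edelsbrunnerHarerNerve (F : Set (Set X)))) (A : Set X),
        0 < (t w : Set X → ℝ) A → A ∈ F ∧ 1 / (F.card + 1 : ℝ) < (w : Set X → ℝ) A := by
  set ε : ℝ := 1 / (F.card + 1 : ℝ) with hε
  have hε0 : 0 < ε := by positivity
  let v : (Set X → ℝ) → Set X → ℝ := fun w A => max 0 (w A - ε)
  have hv0 : ∀ w A, 0 ≤ v w A := fun w A => le_max_left _ _
  have hvlt : ∀ w A, 0 < v w A → ε < w A := fun w A h => by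
    simpa [v] using h
  have hvoff : ∀ w ∈ geometricRealization (edelsbrunnerHarerNerve (F : Set (Set X))),
      ∀ A ∉ F, v w A = 0 := by
    intro w hw A hA
    simp [v, ((mem_geometricRealization_nerve F w).1 hw).2.1 A hA, hε0.le]
  have hpos : ∀ w ∈ geometricRealization (edelsbrunnerHarerNerve (F : Set (Set X))),
      0 < ∑ A ∈ F, v w A := by
    intro w hw
    obtain ⟨-, -, hsum, -⟩ := (mem_geometricRealization_nerve F w).1 hw
    have h1 : ∑ A ∈ F, (w A - ε) ≤ ∑ A ∈ F, v w A :=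
      Finset.sum_le_sum fun A _ => le_max_right _ _
    rw [Finset.sum_sub_distrib, hsum, Finset.sum_const, nsmul_eq_mul] at h1
    -- Truncation removes at most `F.card * ε` of the total mass 1, so some mass survives.
    have h2 : (F.card : ℝ) * ε < 1 := by
      rw [hε, mul_one_div, div_lt_one (by positivity)]
      linarith
    linarith
  have hmem : ∀ w ∈ geometricRealization (edelsbrunnerHarerNerve (F : Set (Set X))),
      (fun A => v w A / ∑ B ∈ F, v w B) ∈
        geometricRealization (edelsbrunnerHarerNerve (F : Set (Set X))) := by
    intro w hw
    obtain ⟨-, -, -, x, hx⟩ := (mem_geometricRealization_nerve F w).1 hw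
    exact div_sum_mem_geometricRealization_nerve F (v w) (hv0 w) (hvoff w hw) (hpos w hw)
      ⟨x, fun A hA => hx A (hε0.trans (hvlt w A hA))⟩
  have hvc : ∀ A, Continuous fun w => v w A := fun A => by
    simp only [v]
    fun_prop
  let t : C(geometricRealization (edelsbrunnerHarerNerve (F : Set (Set X))),
        geometricRealization (edelsbrunnerHarerNerve (F : Set (Set X)))) :=
    ⟨fun w => ⟨_, hmem w w.2⟩, Continuous.subtype_mk (continuous_pi fun A =>
      ((hvc A).comp continuous_subtype_val).div
        ((continuous_finsetSum F fun B _ => hvc B).comp continuous_subtype_val)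
        fun w => (hpos w.1 w.2).ne') _⟩
  have ht : ∀ (w : geometricRealization (edelsbrunnerHarerNerve (F : Set (Set X)))) (A : Set X),
      0 < (t w : Set X → ℝ) A → A ∈ F ∧ ε < (w : Set X → ℝ) A := by
    intro w A h
    have h' : 0 < v w A := (div_pos_iff_of_pos_right (hpos w w.2)).1 h
    refine ⟨?_, hvlt w A h'⟩
    by_contra hA
    exact h'.ne' (hvoff w w.2 A hA)
  refine ⟨t, ContinuousMap.homotopic_of_segment_subset _ _ fun w => ?_, ht⟩
  exact segment_subset_geometricRealization_nerve F w.2 (t w).2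
    fun A hA => hε0.trans (ht w A hA).2

/-- The nerve theorem for finite families of nonempty closed convex sets. -/
theorem nonempty_homotopyEquiv_nerve_sUnion (F : Finset (Set E)) (hcl : ∀ A ∈ F, IsClosed A)
    (hne : ∀ A ∈ F, A.Nonempty) (hconv : ∀ A ∈ F, Convex ℝ A) :
    Nonempty (ContinuousMap.HomotopyEquiv
      (geometricRealization (edelsbrunnerHarerNerve (F : Set (Set E))))
      (⋃₀ (F : Set (Set E)))) := by
  obtain ⟨g, hg⟩ := exists_map_to_nerve F hcl hne
  obtain ⟨f, hf⟩ := exists_map_from_nerve F hconv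
  obtain ⟨t, hidt, ht⟩ := exists_homotopic_id_truncating F
  refine ⟨⟨f, g, ?_, ?_⟩⟩
  · refine ContinuousMap.Homotopic.trans
      (ContinuousMap.homotopic_of_segment_subset _ t fun w => ?_) hidt.symm
    -- The support of `t w` is contained in that of `g (f w)`: `t w A > 0` gives `w A > ε`, hence `f
    -- w ∈ A`.
    refine segment_subset_geometricRealization_nerve F (g (f w)).2 (t w).2 fun A hA => ?_
    obtain ⟨hAF, hwA⟩ := ht w A hA
    exact lt_trans (by positivity) (hg (f w) A hAF (hf w A hAF hwA.le))
  · refine ContinuousMap.homotopic_of_segment_subset _ _ fun x => ?_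
    obtain ⟨A, hA, hx⟩ := x.2
    exact ((hconv A hA).segment_subset (hf (g x) A hA (hg x A hA hx).le) hx).trans
      (subset_sUnion_of_mem hA)

end Nerve

/-! ### Voronoi regions and the nucleus cluster -/

theorem voronoiRegion_eq_biInter (S : Set Plane) (s : Plane) :
    voronoiRegion S s = ⋂ q ∈ S, {x | ‖x - s‖ ≤ ‖x - q‖} := by
  ext x
  simp [voronoiRegion]

theorem isClosed_voronoiRegion (S : Set Plane) (s : Plane) : IsClosed (voronoiRegion S s) := by
  rw [voronoiRegion_eq_biInter]
  exact isClosed_biInter fun q _ => isClosed_le (by fun_prop) (by fun_prop)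

theorem convex_voronoiRegion (S : Set Plane) (s : Plane) : Convex ℝ (voronoiRegion S s) := by
  rw [voronoiRegion_eq_biInter]
  refine convex_iInter₂ fun q _ => ?_
  -- Squaring cancels `‖x‖ ^ 2` and leaves a condition linear in `x`.
  have h : {x : Plane | ‖x - s‖ ≤ ‖x - q‖} =
      {x | innerSL ℝ (q - s) x ≤ (‖q‖ ^ 2 - ‖s‖ ^ 2) / 2} := by
    ext x
    rw [mem_ofPred_eq, mem_ofPred_eq, ← sq_le_sq₀ (norm_nonneg _) (norm_nonneg _),
      norm_sub_sq_real, norm_sub_sq_real, innerSL_apply_apply, inner_sub_left,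
      real_inner_comm x q, real_inner_comm x s]
    constructor <;> intro h <;> linarith
  rw [h]
  exact convex_halfSpace_le (innerSL ℝ (q - s)).toLinearMap.isLinear _

/-- Nonemptiness matters because `infDist` to the empty set is `0`, which would defeat the
thickening. -/
theorem self_mem_voronoiRegion (S : Set Plane) (s : Plane) : s ∈ voronoiRegion S s := by
  intro q _
  simp

theorem mncNerve_eq (δ : Set Plane → Set Plane → Prop) (hδ : IsStrongProximity δ)
    (𝒳 : Set (Set Plane)) (N : Set Plane) :
    mncNerve δ 𝒳 N = edelsbrunnerHarerNerve (nucleusCluster δ 𝒳 N) := by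
  ext σ
  exact ⟨fun h => h.1, fun h => ⟨h, fun A hA => (hδ.symm A N).1 (h.2.1 hA).2⟩⟩

theorem mainTheorem1 (δ : Set Plane → Set Plane → Prop) (hδ : IsStrongProximity δ)
    (S : Set Plane) (N : Set Plane) (hN : IsMaximalNucleus δ (voronoiTessellation S) N)
    (hfin : (nucleusCluster δ (voronoiTessellation S) N).Finite) :
    Nonempty (ContinuousMap.HomotopyEquiv
      (geometricRealization (mncNerve δ (voronoiTessellation S) N))
      (⋃₀ nucleusCluster δ (voronoiTessellation S) N)) := by
  rw [mncNerve_eq δ hδ]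
  have h : ∀ A ∈ hfin.toFinset, ∃ s, A = voronoiRegion S s := by
    intro A hA
    obtain ⟨⟨s, -, hs⟩, -⟩ := hfin.mem_toFinset.1 hA
    exact ⟨s, hs⟩
  have key := nonempty_homotopyEquiv_nerve_sUnion hfin.toFinset
    (fun A hA => by obtain ⟨s, rfl⟩ := h A hA; exact isClosed_voronoiRegion S s)
    (fun A hA => by obtain ⟨s, rfl⟩ := h A hA; exact ⟨s, self_mem_voronoiRegion S s⟩)
    (fun A hA => by obtain ⟨s, rfl⟩ := h A hA; exact convex_voronoiRegion S s)
  rwa [hfin.coe_toFinset] at key
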